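/- Let $X$ and $Y$ be arbitrary sets, let $\mathcal{PT}_{XY}$ be the set of all partial functions $X\to Y$, and fix a partial function $a:Y\to X$. The sandwich semigroup $\mathcal{PT}_{XY}^a$ is the set $\mathcal{PT}_{XY}$ with the product $f\star_a g=fag$ (first apply $f$, then $a$, then $g$). Let $P^a=\operatorname{Reg}(\mathcal{PT}_{XY}^a)$ be the subsemigroup of all regular elements of $\mathcal{PT}_{XY}^a$, i.e. of all $f$ with $f=f\star_a g\star_a f$ for some $g\in\mathcal{PT}_{XY}$. The rank $\operatorname{rank}(S)$ of a semigroup $S$ is the least cardinality of a subset generating $S$ as a semigroup. Write $\operatorname{im}(a)=\{a_i:i\in I\}$ with the $a_i$ pairwise distinct, and put $A_i=\{y\in\operatorname{dom}(a): ya=a_i\}$, $\alpha=|I|=|\operatorname{im}(a)|$, $\beta=|X\setminus\operatorname{im}(a)|$, $\lambda_i=|A_i|$ for $i\in I$, and $\Lambda_I=\prod_{i\in I}\lambda_i$ (so $\Lambda_I=1$ if $I=\emptyset$). (i) If $|P^a|\ge\aleph_0$, then $\operatorname{rank}(P^a)=|P^a|$. (ii) If $|P^a|<\aleph_0$, then either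 $\alpha=0$, or $|X|<\aleph_0$ and $\lambda_i<\aleph_0$ for all $i\in I$; moreover $$\operatorname{rank}(P^a)=\begin{cases}1&\text{if }\alpha=0,\\ 1+\max(2^\beta,\Lambda_I)&\text{if }\alpha=1,\\ 2+\max(3^\beta,\Lambda_I)&\text{if }\alpha=2,\\ 2+\max((\alpha+1)^\beta,\Lambda_I,2)&\text{if }\alpha\ge3.\end{cases}$$ -/

import Mathlib

open Cardinal

universe u v

/-- The underlying set of the sandwich semigroup with sandwich element `a : Y →. X`: all partial
functions `X →. Y`. -/
def SandwichPT {X : Type u} {Y : Type v} (_a : Y →. X) : Type (max u v) := X →. Y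

namespace SandwichPT

variable {X : Type u} {Y : Type v} {a : Y →. X}

/-- The sandwich product `f ⋆ g = f a g`: first apply `f`, then `a`, then `g`. -/
def sandwichMul (a : Y →. X) (f g : X →. Y) : X →. Y := PFun.comp g (PFun.comp a f)

theorem sandwichMul_assoc (a : Y →. X) (f g h : X →. Y) :
    sandwichMul a (sandwichMul a f g) h = sandwichMul a f (sandwichMul a g h) := by
  simp only [sandwichMul, PFun.comp_assoc]

instance : Semigroup (SandwichPT a) where
  mul f g := sandwichMul a f g
  mul_assoc f g h := sandwichMul_assoc a f g h

/-- Every partial function is (von Neumann) regular in the category of partial functions. -/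
theorem exists_comp_comp_eq (p : Y →. X) : ∃ w : X →. Y, PFun.comp p (PFun.comp w p) = p := by
  classical
  refine ⟨fun x => ⟨∃ y, x ∈ p y, fun h => h.choose⟩, ?_⟩
  refine PFun.ext fun y x => ?_
  constructor
  · intro hx
    obtain ⟨y', hy', hx⟩ := Part.mem_bind_iff.1 hx
    obtain ⟨x', hx', h, rfl⟩ := Part.mem_bind_iff.1 hy'
    have e : x = x' := Part.mem_unique hx h.choose_spec
    exact e ▸ hx'
  · intro hx
    have h : ∃ y, x ∈ p y := ⟨y, hx⟩
    exact Part.mem_bind_iff.2 ⟨h.choose, Part.mem_bind_iff.2 ⟨x, hx, h, rfl⟩, h.choose_spec⟩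

theorem exists_sandwichMul_eq (a : Y →. X) (f g : X →. Y) : ∃ w : X →. Y, ∀ h k : X →. Y,
    sandwichMul a (sandwichMul a (sandwichMul a f h) (sandwichMul a (sandwichMul a (sandwichMul a f g) w) (sandwichMul a f g))) (sandwichMul a k g) =
      sandwichMul a (sandwichMul a (sandwichMul a f h) (sandwichMul a f g)) (sandwichMul a k g) := by
  obtain ⟨w, hw⟩ := exists_comp_comp_eq
    (PFun.comp a (PFun.comp g (PFun.comp a (PFun.comp f a))))
  refine ⟨w, fun h k => ?_⟩
  have hw' := congrArg (fun q : Y →. X => PFun.comp g (PFun.comp a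
      (PFun.comp k (PFun.comp q (PFun.comp h (PFun.comp a f)))))) hw
  simp only [sandwichMul, PFun.comp_assoc] at hw' ⊢
  exact hw'

end SandwichPT

/-- An element `x` of a semigroup is regular if `x = x y x` for some `y`. -/
def IsRegularElement {S : Type*} [Mul S] (x : S) : Prop := ∃ y : S, x = x * y * x

/-- The rank of a semigroup: the least cardinality of a generating set. -/
noncomputable def semigroupRank (S : Type u) [Semigroup S] : Cardinal.{u} :=
  sInf {κ : Cardinal.{u} | ∃ A : Set S, Subsemigroup.closure A = ⊤ ∧ #A = κ}

namespace SandwichPT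

variable {X : Type u} {Y : Type v}

theorem isRegularElement_mul {a : Y →. X} {f g : SandwichPT a}
    (hf : IsRegularElement f) (hg : IsRegularElement g) : IsRegularElement (f * g) := by
  obtain ⟨h, hf⟩ := hf
  obtain ⟨k, hg⟩ := hg
  obtain ⟨w, hw⟩ := exists_sandwichMul_eq a f g
  let w' : SandwichPT a := w
  refine ⟨w', ?_⟩
  have key : (f * h) * (f * g * w' * (f * g)) * (k * g) = (f * h) * (f * g) * (k * g) := hw h k
  have e : (f * h) * (f * g) * (k * g) = f * g := by
    calc (f * h) * (f * g) * (k * g) = (f * h * f) * (g * k * g) := by simp only [mul_assoc]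
      _ = f * g := by rw [← hf, ← hg]
  calc f * g = (f * h) * (f * g * w' * (f * g)) * (k * g) := by rw [key, e]
    _ = (f * h * f) * g * w' * f * (g * k * g) := by simp only [mul_assoc]
    _ = f * g * w' * (f * g) := by rw [← hf, ← hg]; simp only [mul_assoc]

/-- `P^a = Reg(PT_{XY}^a)`, the subsemigroup of all regular elements of the sandwich semigroup. -/
def regularPart (a : Y →. X) : Subsemigroup (SandwichPT a) where
  carrier := {f | IsRegularElement f}
  mul_mem' := isRegularElement_mul

/-- `α = rank(a) = |im(a)|`. -/
noncomputable def alpha (a : Y →. X) : Cardinal.{u} := #a.ran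

/-- `β = |X ∖ im(a)|`. -/
noncomputable def beta (a : Y →. X) : Cardinal.{u} := #↥(a.ranᶜ)

/-- `λ_i = |A_i|`, where `A_i ⊆ Y` is the preimage under `a` of the point `i` of `im(a)`; the
index set `I` is `im(a)` itself. -/
noncomputable def lam (a : Y →. X) (i : a.ran) : Cardinal.{v} := #{y : Y | (i : X) ∈ a y}

/-- `Λ_I`, the product of all the `λ_i`. -/
noncomputable def Lam (a : Y →. X) : Cardinal.{max u v} := Cardinal.prod (lam a)

end SandwichPT

open SandwichPT

/-!
Put `I = im a`. A regular element `f` of the sandwich semigroup is given by three coordinates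
`(η, τ, t)`: a partial retraction `η` of `X` onto `I`, a partial transformation `τ` of `I`, and a
section `t : I → Y` of `a`; then `f = η τ t` (first `η`, then `τ`, then `t`). Since
`t a η = id` on `I`, the sandwich product is `(η τ t) ⋆ (η' τ' t') = η (τ τ') t'`. So the regular
part is the image of the rectangular product of the monoid of partial transformations of `I` by the
set `L` of retractions and the set `R` of sections
(`SandwichPT.ofCoordinates_mul`, `SandwichPT.coordinatesHom_surjective`). Here `|L| = (α + 1) ^ β`
and `|R| = Λ_I`. The middle coordinate `τ` is always determined by `f`, and all three are if `τ` is
a permutation (`SandwichPT.eq_of_coordinatesHom_eq`).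

Let `I` be finite. Elements whose `τ` is not a permutation form an ideal. Therefore the generators
over permutations have to generate `L × Sym(I) × R`; as products have the left coordinate of the
first and the right coordinate of the last factor, there are at least `max(|L|, |R|)` of them, and
at least two if `Sym(I)` is not commutative. Among the other generators at least one is not total,
and if `α ≥ 2` another one is total (`RectangularProduct.exists_not_total`,
`RectangularProduct.exists_total_not_isUnit`). Conversely, any family over permutations that covers
`L`, `R` and a generating set of `Sym(I)` generates `L × Sym(I) × R`
(`RectangularProduct.mk_mem_of_submonoid_closure_eq_top`), `Sym(I)` has two generators, and the
permutations together with two collapses of defect one generate all partial transformations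
(`PartialTransformation.mem_of_ofPerm_mem`).

If the regular part is infinite, then it is not finitely generated: if it is countable and `I` is
nonempty, then `X` is finite, so there are infinitely many sections, and each of them is the right
coordinate of some generator. An infinite generating set of a semigroup has the
cardinality of the semigroup.
-/

/-! ### The monoid of partial transformations -/

/-- The monoid of partial transformations of `I`, encoded as functions `I → Option I`. Products are
read from left to right: in `f * g` the factor `f` is applied first. -/
@[ext]
structure PartialTransformation (I : Type u) : Type u where
  /-- The underlying function, with value `none` where the partial transformation is undefined. -/
  toFun : I → Option I

namespace PartialTransformation

variable {I : Type u}

instance : CoeFun (PartialTransformation I) fun _ => I → Option I := ⟨toFun⟩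

theorem ext_apply {f g : PartialTransformation I} (h : ∀ i, f i = g i) : f = g :=
  PartialTransformation.ext (funext h)

/-- The identification of partial transformations with functions `I → Option I`. -/
def equivFun : PartialTransformation I ≃ (I → Option I) := ⟨toFun, mk, fun _ => rfl, fun _ => rfl⟩

instance : Monoid (PartialTransformation I) where
  mul f g := ⟨fun i => (f i).bind g⟩
  one := ⟨some⟩
  mul_assoc _ _ _ := ext_apply fun _ => Option.bind_assoc _ _ _
  one_mul _ := rfl
  mul_one _ := ext_apply fun _ => Option.bind_fun_some _

theorem mul_apply (f g : PartialTransformation I) (i : I) : (f * g) i = (f i).bind g := rfl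

theorem one_apply (i : I) : (1 : PartialTransformation I) i = some i := rfl

instance [Finite I] : Finite (PartialTransformation I) := Finite.of_equiv _ equivFun.symm

/-- A permutation as a partial transformation. The inverse makes this a homomorphism, as
permutations are composed from right to left and partial transformations from left to right. -/
def ofPerm : Equiv.Perm I →* PartialTransformation I where
  toFun σ := ⟨fun i => some (σ⁻¹ i)⟩
  map_one' := rfl
  map_mul' _ _ := rfl

theorem ofPerm_apply (σ : Equiv.Perm I) (i : I) : ofPerm σ i = some (σ⁻¹ i) := rfl

theorem ofPerm_injective : Function.Injective (ofPerm (I := I)) := fun σ τ h => by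
  have : σ⁻¹ = τ⁻¹ := Equiv.ext fun i =>
    Option.some_injective _ (congrArg (fun m : PartialTransformation I => m i) h)
  exact inv_injective this

theorem isUnit_ofPerm (σ : Equiv.Perm I) : IsUnit (ofPerm σ) :=
  (Group.isUnit σ).map ofPerm

theorem isUnit_iff {m : PartialTransformation I} : IsUnit m ↔ ∃ σ, m = ofPerm σ := by
  refine ⟨?_, by rintro ⟨σ, rfl⟩; exact isUnit_ofPerm σ⟩
  rintro ⟨⟨m, n, hmn, hnm⟩, rfl⟩
  have key : ∀ {p q : PartialTransformation I}, p * q = 1 →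
      ∀ i, ∃ j, p i = some j ∧ q j = some i := by
    intro p q h i
    have := congrArg (fun m : PartialTransformation I => m i) h
    rw [mul_apply, one_apply, Option.bind_eq_some_iff] at this
    exact this
  choose f hf hf' using key hmn
  choose g hg hg' using key hnm
  refine ⟨⟨g, f, fun i => ?_, fun i => ?_⟩, ext_apply hf⟩
  · exact Option.some_injective _ ((hf _).symm.trans (hg' i))
  · exact Option.some_injective _ ((hg _).symm.trans (hf' i))

theorem isUnit_of_surjective [Finite I] {m : PartialTransformation I}
    (h : ∀ j, ∃ i, m i = some j) : IsUnit m := by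
  choose g hg using h
  have inj : Function.Injective g := fun i j e =>
    Option.some_injective _ ((hg i).symm.trans (e ▸ hg j))
  let σ := Equiv.ofBijective g (Finite.injective_iff_bijective.1 inj)
  refine isUnit_iff.2 ⟨σ, ext_apply fun i => ?_⟩
  have : g (σ⁻¹ i) = i := σ.apply_symm_apply i
  rw [ofPerm_apply, ← hg, this]

theorem exists_mul_mul_eq (m : PartialTransformation I) : ∃ n, m * n * m = m := by
  classical
  refine ⟨⟨fun j => if h : ∃ i, m i = some j then some h.choose else none⟩, ext_apply fun i => ?_⟩
  simp only [mul_apply]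
  cases hi : m i with
  | none => rfl
  | some j =>
    have h : ∃ i, m i = some j := ⟨i, hi⟩
    simp [h, h.choose_spec]

/-- The partial transformation that moves `z` to `w`, or is undefined at `z` if `w = none`, and
fixes all other points. -/
def collapse [DecidableEq I] (z : I) (w : Option I) : PartialTransformation I :=
  ⟨fun i => if i = z then w else some i⟩

/-- Undefined points and collisions are treated alike: a partial transformation is a total
function on `Option I` fixing `none`. If such a function misses a point `z` then two points
`x ≠ none` and `y` have the same image; moving `x` to `z` gives a function with a larger image, from
which the original one is recovered by composing with a collapse. -/
theorem mem_of_ofPerm_mem_of_collapse_mem [Finite I] [DecidableEq I]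
    (N : Submonoid (PartialTransformation I)) (hp : ∀ σ, ofPerm σ ∈ N)
    (hc : ∀ z w, w ≠ some z → collapse z w ∈ N) (m : PartialTransformation I) : m ∈ N := by
  induction hn : {j | ∀ i, m i ≠ some j}.ncard using Nat.strong_induction_on generalizing m with
  | _ n ih =>
  -- `n` is the number of points outside the image
  by_cases hs : ∀ j, ∃ i, m i = some j
  · obtain ⟨σ, rfl⟩ := isUnit_iff.1 (isUnit_of_surjective hs)
    exact hp σ
  push Not at hs
  obtain ⟨z, hz⟩ := hs
  -- a total injective function on a finite set would not miss `z`
  have hxy : ∃ x, m x = none ∨ ∃ y, y ≠ x ∧ m x = m y := by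
    by_contra! h
    choose f hf using fun x => Option.ne_none_iff_exists'.1 (h x).1
    have inj : Function.Injective f := by
      intro x y e
      by_contra hne
      exact (h x).2 y (Ne.symm hne) (by rw [hf, hf, e])
    obtain ⟨i, hi⟩ := Finite.surjective_of_injective inj z
    exact hz i ((hf i).trans (congrArg some hi))
  obtain ⟨x, hx⟩ := hxy
  let m' : PartialTransformation I := ⟨fun i => if i = x then some z else m i⟩
  have e : m = m' * collapse z (m x) := by
    refine ext_apply fun i => ?_
    rw [mul_apply]
    by_cases hi : i = x
    · simp [m', hi, collapse]
    · simp only [m', hi, if_false]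
      cases h : m i with
      | none => rfl
      | some j =>
        have : j ≠ z := fun e => hz i (e ▸ h)
        simp [collapse, this]
  rw [e]
  refine N.mul_mem (ih _ ?_ m' rfl) (hc z _ (hz x))
  rw [← hn]
  refine Set.ncard_lt_ncard ⟨fun j hj i hi => ?_, fun h => ?_⟩ (Set.toFinite _)
  · have key : ∃ i', i' ≠ x ∧ m i' = some j := by
      by_cases hix : i = x
      · subst hix
        rcases hx with hx | ⟨y, hy, hxy⟩
        · simp [hx] at hi
        · exact ⟨y, hy, hxy ▸ hi⟩
      · exact ⟨i, hix, hi⟩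
    obtain ⟨i', hi', h⟩ := key
    exact hj i' (by simp [m', hi', h])
  · exact h (show z ∈ {j | ∀ i, m i ≠ some j} from hz) x (by simp [m'])

theorem ofPerm_mul_collapse_mul_ofPerm [DecidableEq I] (σ : Equiv.Perm I) (z : I) (w : Option I) :
    ofPerm σ * collapse z w * ofPerm σ⁻¹ = collapse (σ z) (w.map σ) := by
  refine ext_apply fun i => ?_
  rw [mul_apply, mul_apply, ofPerm_apply, Option.bind_some]
  by_cases h : i = σ z
  · subst h
    cases w <;> simp [collapse, ofPerm_apply]
  · have : σ⁻¹ i ≠ z := fun e => h (by simp [← e])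
    simp only [collapse, this, h, if_false, Option.bind_some, ofPerm_apply]
    simp

/-- Up to conjugation by permutations there are two collapses: an undefined point and a collision.
The second is only needed when `I` has two points. -/
theorem mem_of_ofPerm_mem [Finite I] [DecidableEq I]
    (N : Submonoid (PartialTransformation I)) (hp : ∀ σ, ofPerm σ ∈ N) {z₀ : I}
    (h₁ : collapse z₀ none ∈ N)
    (h₂ : Subsingleton I ∨ ∃ w₀ ≠ z₀, collapse z₀ (some w₀) ∈ N)
    (m : PartialTransformation I) : m ∈ N := by
  have conj : ∀ (σ : Equiv.Perm I) {w}, collapse z₀ w ∈ N → collapse (σ z₀) (w.map σ) ∈ N :=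
    fun σ w h => ofPerm_mul_collapse_mul_ofPerm σ z₀ w ▸
      N.mul_mem (N.mul_mem (hp σ) h) (hp σ⁻¹)
  refine mem_of_ofPerm_mem_of_collapse_mem N hp (fun z w hw => ?_) m
  cases w with
  | none => simpa using conj (Equiv.swap z₀ z) h₁
  | some j =>
    have hj : j ≠ z := fun e => hw (e ▸ rfl)
    rcases h₂ with h | ⟨w₀, hw₀, h₂⟩
    · exact absurd (Subsingleton.elim j z) hj
    -- a permutation with `z₀ ↦ z` and `w₀ ↦ j`
    · have h := conj (Equiv.swap (Equiv.swap z₀ z w₀) j * Equiv.swap z₀ z) h₂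
      have h3 : z ≠ Equiv.swap z₀ z w₀ := fun e => hw₀ <| by
        have := congrArg (Equiv.swap z₀ z) e
        simpa using this.symm
      simpa [Equiv.swap_apply_of_ne_of_ne h3 hj.symm] using h

end PartialTransformation

/-! ### Generators of finite symmetric groups -/

theorem Equiv.Perm.exists_submonoid_closure_singleton {I : Type u} [Finite I] (h : Nat.card I ≤ 2) :
    ∃ σ : Equiv.Perm I, Submonoid.closure {σ} = ⊤ := by
  classical
  have := Fintype.ofFinite I
  have : IsCyclic (Equiv.Perm I) := by
    have hc : Nat.card (Equiv.Perm I) = (Nat.card I).factorial := Nat.card_perm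
    interval_cases hI : Nat.card I
    · have := (Nat.card_eq_one_iff_unique.1 (hc.trans rfl)).1
      infer_instance
    · have := (Nat.card_eq_one_iff_unique.1 (hc.trans rfl)).1
      infer_instance
    · have : Fact (Nat.Prime 2) := ⟨Nat.prime_two⟩
      exact isCyclic_of_prime_card (p := 2) hc
  obtain ⟨σ, hσ⟩ := IsCyclic.exists_generator (α := Equiv.Perm I)
  refine ⟨σ, ?_⟩
  rw [← Subgroup.closure_toSubmonoid_of_finite, ← Subgroup.zpowers_eq_closure,
    (Subgroup.eq_top_iff' _).2 hσ, Subgroup.top_toSubmonoid]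

theorem Equiv.Perm.exists_submonoid_closure_pair {I : Type u} [Finite I] [Nontrivial I] :
    ∃ σ τ : Equiv.Perm I, Submonoid.closure {σ, τ} = ⊤ := by
  classical
  have := Fintype.ofFinite I
  obtain ⟨σ, hσ, -⟩ := (Finset.univ : Finset I).exists_cycleOn
  have hu : ((Finset.univ : Finset I) : Set I).Nontrivial := by
    simpa using Set.nontrivial_univ
  have hc : σ.IsCycle := Equiv.Perm.isCycle_iff_exists_isCycleOn.2
    ⟨_, hu, hσ, fun x _ => by simp⟩
  have hs : σ.support = Finset.univ := by
    ext x
    simpa using hσ.apply_ne hu (by simp)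
  obtain ⟨x, -⟩ := exists_pair_ne I
  refine ⟨σ, Equiv.swap x (σ x), ?_⟩
  rw [← Subgroup.closure_toSubmonoid_of_finite,
    Equiv.Perm.closure_cycle_adjacent_swap hc hs x, Subgroup.top_toSubmonoid]

theorem Equiv.Perm.exists_not_commute {I : Type u} [Finite I] (h : 3 ≤ Nat.card I) :
    ∃ σ τ : Equiv.Perm I, σ * τ ≠ τ * σ := by
  classical
  have := Fintype.ofFinite I
  rw [Nat.card_eq_fintype_card] at h
  obtain ⟨x, y, z, hxy, hxz, hyz⟩ := Fintype.two_lt_card_iff.1 h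
  refine ⟨Equiv.swap x y, Equiv.swap x z, fun e => hyz ?_⟩
  have := Equiv.congr_fun e x
  simp [Equiv.swap_apply_of_ne_of_ne hxz.symm hyz.symm,
    Equiv.swap_apply_of_ne_of_ne hxy.symm hyz] at this
  exact this.symm

/-! ### Rectangular products -/

/-- The direct product of a left zero semigroup on `L`, a monoid `M` and a right zero semigroup on
`R`. -/
@[ext]
structure RectangularProduct (L : Type u) (M : Type u) (R : Type v) where
  /-- The component in the left zero semigroup. -/
  left : L
  /-- The component in the monoid. -/
  mid : M
  /-- The component in the right zero semigroup. -/
  right : R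

namespace RectangularProduct

variable {L M : Type u} {R : Type v}

/-- A rectangular product as a product of types. -/
def equivProd : RectangularProduct L M R ≃ L × M × R :=
  ⟨fun q => ⟨q.left, q.mid, q.right⟩, fun p => ⟨p.1, p.2.1, p.2.2⟩, fun _ => rfl, fun _ => rfl⟩

instance [Finite L] [Finite M] [Finite R] : Finite (RectangularProduct L M R) :=
  Finite.of_equiv _ equivProd.symm

instance [Monoid M] : Semigroup (RectangularProduct L M R) where
  mul p q := ⟨p.left, p.mid * q.mid, q.right⟩
  mul_assoc p q r :=
    RectangularProduct.ext rfl (mul_assoc p.mid q.mid r.mid) rfl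

variable [Monoid M]

theorem mk_mul_mk (l l' : L) (m m' : M) (r r' : R) :
    (⟨l, m, r⟩ * ⟨l', m', r'⟩ : RectangularProduct L M R) = ⟨l, m * m', r'⟩ := rfl

theorem mid_mul (p q : RectangularProduct L M R) : (p * q).mid = p.mid * q.mid := rfl

/-- The elements over units form the complement of an ideal, hence those in the subsemigroup
generated by `A` are products of elements of `A` over units. -/
theorem exists_of_isUnit [Finite M] {A : Set (RectangularProduct L M R)}
    {q : RectangularProduct L M R} (hq : q ∈ Subsemigroup.closure A) (hu : IsUnit q.mid) :
    (∃ p ∈ A, IsUnit p.mid ∧ p.left = q.left) ∧ (∃ p ∈ A, IsUnit p.mid ∧ p.right = q.right) ∧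
      q.mid ∈ Submonoid.closure (mid '' (A ∩ {p | IsUnit p.mid})) := by
  induction hq using Subsemigroup.closure_induction with
  | mem q hq =>
    exact ⟨⟨q, hq, hu, rfl⟩, ⟨q, hq, hu, rfl⟩, Submonoid.subset_closure ⟨q, ⟨hq, hu⟩, rfl⟩⟩
  | mul p q _ _ ihp ihq =>
    obtain ⟨hp, hq⟩ := IsUnit.mul_iff.1 hu
    exact ⟨(ihp hp).1, (ihq hq).2.1, mul_mem (ihp hp).2.2 (ihq hq).2.2⟩

/-- Generators over units that cover `L`, `R` and a generating set of the finite group `G` generate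
all of `L × G × R`. -/
theorem mk_mem_of_submonoid_closure_eq_top {G K : Type*} [Group G] (φ : G →* M)
    (H : Subsemigroup (RectangularProduct L M R)) {l : K → L} {s : K → G} {r : K → R}
    (hs : Submonoid.closure (Set.range s) = ⊤) (hl : Function.Surjective l)
    (hr : Function.Surjective r) (hH : ∀ k, ⟨l k, φ (s k), r k⟩ ∈ H) (x : L) (g : G) (y : R) :
    ⟨x, φ g, y⟩ ∈ H := by
  obtain ⟨k, rfl⟩ := hl x
  obtain ⟨n, rfl⟩ := hr y
  -- the outer factors fix the left and right coordinates, and their middle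
  -- parts can be cancelled in the group
  have key : ∀ w ∈ Submonoid.closure (Set.range s), ∀ n, ⟨l k, φ (s k * w * s n), r n⟩ ∈ H := by
    intro w hw
    induction hw using Submonoid.closure_induction_right with
    | one =>
      intro n
      have := H.mul_mem (hH k) (hH n)
      rwa [mk_mul_mk, ← map_mul, ← mul_one (s k)] at this
    | mul_right w _ _ hj ih =>
      obtain ⟨j, rfl⟩ := hj
      intro n
      have := H.mul_mem (ih j) (hH n)
      rwa [mk_mul_mk, ← map_mul, mul_assoc (s k)] at this
  have := key ((s k)⁻¹ * g * (s n)⁻¹) (hs ▸ Submonoid.mem_top _) n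
  rwa [show s k * ((s k)⁻¹ * g * (s n)⁻¹) * s n = g by group] at this

/-- All elements over permutations, together with one element over each of the two kinds of collapse
(only an undefined point if `I` has no two points), generate the rectangular
product of a finite partial transformation monoid. -/
theorem mem_of_ofPerm_mem {I : Type u} [Finite I] [DecidableEq I]
    (H : Subsemigroup (RectangularProduct L (PartialTransformation I) R))
    (hp : ∀ l σ r, ⟨l, PartialTransformation.ofPerm σ, r⟩ ∈ H) {z₀ : I} {l₀ : L} {r₀ : R}
    (h₁ : ⟨l₀, .collapse z₀ none, r₀⟩ ∈ H)
    (h₂ : Subsingleton I ∨ ∃ w₀ ≠ z₀, ⟨l₀, .collapse z₀ (some w₀), r₀⟩ ∈ H)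
    (q : RectangularProduct L (PartialTransformation I) R) : q ∈ H := by
  have h1 : ∀ l r, (⟨l, 1, r⟩ : RectangularProduct L (PartialTransformation I) R) ∈ H :=
    fun l r => by simpa using hp l 1 r
  have lift : ∀ {m}, ⟨l₀, m, r₀⟩ ∈ H → ∀ l r, ⟨l, m, r⟩ ∈ H := fun h l r => by
    simpa [mk_mul_mk] using H.mul_mem (H.mul_mem (h1 l r₀) h) (h1 l₀ r)
  let N : Submonoid (PartialTransformation I) :=
    { carrier := {m | ∀ (l : L) (r : R), (⟨l, m, r⟩ : RectangularProduct L _ R) ∈ H}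
      one_mem' := h1
      mul_mem' := fun {m m'} hm hm' l r => H.mul_mem (hm l r) (hm' l r) }
  exact PartialTransformation.mem_of_ofPerm_mem N (fun σ l r => hp l σ r) (lift h₁)
    (h₂.imp_right fun ⟨w, hw, h⟩ => ⟨w, hw, lift h⟩) q.mid q.left q.right

section LowerBound

variable {I : Type u} {A : Set (RectangularProduct L (PartialTransformation I) R)}

/-- Total partial transformations are closed under products. -/
theorem exists_not_total (i : I)
    (hA : ∀ m, ∃ q ∈ Subsemigroup.closure A, q.mid = m) : ∃ p ∈ A, ∃ i, p.mid i = none := by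
  by_contra! h
  have key : ∀ q ∈ Subsemigroup.closure A, ∀ i, q.mid i ≠ none := by
    intro q hq
    induction hq using Subsemigroup.closure_induction with
    | mem q hq => exact h q hq
    | mul p q _ _ ihp ihq =>
      intro i
      obtain ⟨j, hj⟩ := Option.ne_none_iff_exists'.1 (ihp i)
      rw [mid_mul, PartialTransformation.mul_apply, hj]
      exact ihq j
  obtain ⟨q, hq, e⟩ := hA ⟨fun _ => none⟩
  exact key q hq i (by rw [e])

/-- If a product is total, then so is its first factor. Were this factor a permutation whenever it
is total, the second factor would be total as well, and no total non-permutation could be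
generated. -/
theorem exists_total_not_isUnit [Nontrivial I]
    (hA : ∀ m, ∃ q ∈ Subsemigroup.closure A, q.mid = m) :
    ∃ p ∈ A, (∀ i, p.mid i ≠ none) ∧ ¬IsUnit p.mid := by
  by_contra! h
  have key : ∀ q ∈ Subsemigroup.closure A, (∀ i, q.mid i ≠ none) → IsUnit q.mid := by
    intro q hq
    induction hq using Subsemigroup.closure_induction with
    | mem q hq => exact h q hq
    | mul p q _ _ ihp ihq =>
      intro ht
      have hp : IsUnit p.mid := ihp fun i hi =>
        ht i (by rw [mid_mul, PartialTransformation.mul_apply, hi]; rfl)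
      obtain ⟨σ, hσ⟩ := PartialTransformation.isUnit_iff.1 hp
      refine hp.mul (ihq fun i hi => ht (σ i) ?_)
      rw [mid_mul, PartialTransformation.mul_apply, hσ, PartialTransformation.ofPerm_apply]
      simpa using hi
  obtain ⟨x, y, hxy⟩ := exists_pair_ne I
  obtain ⟨q, hq, e⟩ := hA ⟨fun _ => some x⟩
  have hu := key q hq fun i => by simp [e]
  rw [e] at hu
  obtain ⟨σ, hσ⟩ := PartialTransformation.isUnit_iff.1 hu
  have h1 := congrArg (fun m : PartialTransformation I => m (σ y)) hσ
  simp [PartialTransformation.ofPerm_apply] at h1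
  exact hxy h1

theorem one_le_mk_diff [Nonempty I]
    (hA : ∀ m, ∃ q ∈ Subsemigroup.closure A, q.mid = m) :
    1 ≤ #↥(A \ {p | IsUnit p.mid}) := by
  obtain ⟨p, hp, i, hi⟩ := exists_not_total (Classical.arbitrary I) hA
  rw [Cardinal.one_le_iff_ne_zero, Cardinal.mk_ne_zero_iff]
  refine ⟨p, hp, fun hu => ?_⟩
  obtain ⟨σ, hσ⟩ := PartialTransformation.isUnit_iff.1 hu
  simp [hσ, PartialTransformation.ofPerm_apply] at hi

theorem two_le_mk_diff [Nontrivial I]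
    (hA : ∀ m, ∃ q ∈ Subsemigroup.closure A, q.mid = m) :
    2 ≤ #↥(A \ {p | IsUnit p.mid}) := by
  obtain ⟨p, hp, i, hi⟩ := exists_not_total (Classical.arbitrary I) hA
  obtain ⟨q, hq, ht, hq'⟩ := exists_total_not_isUnit hA
  have hp' : ¬IsUnit p.mid := fun hu => by
    obtain ⟨σ, hσ⟩ := PartialTransformation.isUnit_iff.1 hu
    simp [hσ, PartialTransformation.ofPerm_apply] at hi
  rw [Cardinal.two_le_iff]
  refine ⟨⟨p, hp, hp'⟩, ⟨q, hq, hq'⟩, fun e => ht i ?_⟩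
  have := congrArg Subtype.val e
  simp only at this
  rw [← this, hi]

/-- A single element over the units would generate a commutative monoid, while the symmetric group
of a set with three points is not commutative. -/
theorem two_le_mk_inter [Finite I] (hI : 3 ≤ Nat.card I)
    (hA : ∀ m, ∃ q ∈ Subsemigroup.closure A, q.mid = m) :
    2 ≤ #↥(A ∩ {p | IsUnit p.mid}) := by
  by_contra hc
  have hs : Subsingleton ↥(A ∩ {p | IsUnit p.mid}) := by
    rw [Cardinal.two_le_iff] at hc
    push Not at hc
    exact ⟨hc⟩
  obtain ⟨σ, τ, h⟩ := Equiv.Perm.exists_not_commute hI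
  have mem : ∀ σ : Equiv.Perm I, PartialTransformation.ofPerm σ ∈
      Submonoid.closure (mid '' (A ∩ {p | IsUnit p.mid})) := fun σ => by
    obtain ⟨q, hq, e⟩ := hA (PartialTransformation.ofPerm σ)
    exact e ▸ (exists_of_isUnit hq (e ▸ PartialTransformation.isUnit_ofPerm σ)).2.2
  refine h (PartialTransformation.ofPerm_injective ?_)
  rw [map_mul, map_mul]
  have comm : ∀ x ∈ mid '' (A ∩ {p | IsUnit p.mid}), ∀ y ∈ mid '' (A ∩ {p | IsUnit p.mid}),
      x * y = y * x := by
    rintro _ ⟨p, hp, rfl⟩ _ ⟨q, hq, rfl⟩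
    have : p = q := congrArg Subtype.val (hs.elim ⟨p, hp⟩ ⟨q, hq⟩)
    rw [this]
  have := (Submonoid.isMulCommutative_closure _ comm).is_comm.comm ⟨_, mem σ⟩ ⟨_, mem τ⟩
  exact congrArg Subtype.val this

theorem surjective_left [Finite I] [Nonempty R]
    (hA : ∀ q, IsUnit q.mid → q ∈ Subsemigroup.closure A) :
    Function.Surjective fun p : ↥(A ∩ {p | IsUnit p.mid}) => p.1.left := fun l => by
  obtain ⟨p, hp, hu, e⟩ :=
    (exists_of_isUnit (hA ⟨l, 1, Classical.arbitrary R⟩ isUnit_one) isUnit_one).1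
  exact ⟨⟨p, hp, hu⟩, e⟩

theorem surjective_right [Finite I] [Nonempty L]
    (hA : ∀ q, IsUnit q.mid → q ∈ Subsemigroup.closure A) :
    Function.Surjective fun p : ↥(A ∩ {p | IsUnit p.mid}) => p.1.right := fun r => by
  obtain ⟨p, hp, hu, e⟩ :=
    (exists_of_isUnit (hA ⟨Classical.arbitrary L, 1, r⟩ isUnit_one) isUnit_one).2.1
  exact ⟨⟨p, hp, hu⟩, e⟩

end LowerBound

end RectangularProduct

/-! ### Coordinates on the regular part of a sandwich semigroup -/

namespace SandwichPT

variable {X : Type u} {Y : Type v} {a : Y →. X}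

theorem mem_mul {f g : SandwichPT a} {x : X} {z : Y} :
    z ∈ (f * g) x ↔ ∃ y ∈ f x, ∃ x' ∈ a y, z ∈ g x' := by
  constructor
  · intro h
    obtain ⟨x', h, hz⟩ := Part.mem_bind_iff.1 h
    obtain ⟨y, hy, hx'⟩ := Part.mem_bind_iff.1 h
    exact ⟨y, hy, x', hx', hz⟩
  · rintro ⟨y, hy, x', hx', hz⟩
    exact Part.mem_bind_iff.2 ⟨x', Part.mem_bind_iff.2 ⟨y, hy, hx'⟩, hz⟩

/-- Partial retractions of `X` onto the image of `a`, given by their values outside this image. -/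
abbrev Retraction (a : Y →. X) : Type u := ↥(a.ranᶜ) → Option a.ran

/-- Sections of `a` over its image. -/
abbrev ASection (a : Y →. X) : Type (max u v) := ∀ i : a.ran, ↥{y : Y | (i : X) ∈ a y}

instance : Nonempty (ASection a) := ⟨fun i => ⟨i.2.choose, i.2.choose_spec⟩⟩

theorem mk_retraction : #(Retraction a) = (alpha a + 1) ^ beta a := by
  simp [alpha, beta, Retraction]

theorem mk_aSection : #(ASection a) = Lam a := Cardinal.mk_pi _

open Classical in
/-- The partial map `X → im a` that extends the identity of `im a` by `η`. -/
noncomputable def Retraction.extend (η : Retraction a) (x : X) : Option a.ran :=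
  if h : x ∈ a.ran then some ⟨x, h⟩ else η ⟨x, h⟩

theorem Retraction.extend_coe (η : Retraction a) (i : a.ran) : η.extend i = some i := by
  simp [extend]

theorem Retraction.extend_compl (η : Retraction a) (b : ↥(a.ranᶜ)) : η.extend b = η b := by
  have : (b : X) ∉ a.ran := b.2
  simp [extend, this]

/-- A partial retraction, a partial transformation of `im a` and a section of `a`. -/
abbrev Coordinates (a : Y →. X) : Type (max u v) :=
  RectangularProduct (Retraction a) (PartialTransformation a.ran) (ASection a)

/-- The composition of a partial retraction onto `im a`, a partial transformation of `im a` and a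
section of `a`, as an element of the sandwich semigroup. -/
noncomputable def ofCoordinates (q : Coordinates a) : SandwichPT a := fun x =>
  Part.ofOption (((q.left.extend x).bind q.mid).map fun j => (q.right j : Y))

theorem mem_ofCoordinates {q : Coordinates a} {x : X} {y : Y} : y ∈ ofCoordinates q x ↔
    ∃ i j, q.left.extend x = some i ∧ q.mid i = some j ∧ (q.right j : Y) = y := by
  simp only [ofCoordinates, Part.mem_ofOption, Option.mem_def, Option.map_eq_some_iff,
    Option.bind_eq_some_iff]
  constructor
  · rintro ⟨j, ⟨i, hi, hj⟩, h⟩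
    exact ⟨i, j, hi, hj, h⟩
  · rintro ⟨i, j, hi, hj, h⟩
    exact ⟨j, ⟨i, hi, hj⟩, h⟩

theorem mem_ofCoordinates_coe {q : Coordinates a} {i : a.ran} {y : Y} :
    y ∈ ofCoordinates q i ↔ ∃ j, q.mid i = some j ∧ (q.right j : Y) = y := by
  simp [mem_ofCoordinates, Retraction.extend_coe]

/-- A section followed by `a` and by a retraction is the identity of `im a`. -/
theorem ofCoordinates_mul (p q : Coordinates a) :
    ofCoordinates (p * q) = ofCoordinates p * ofCoordinates q := by
  refine PFun.ext fun x z => ?_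
  refine Iff.trans ?_ mem_mul.symm
  rw [mem_ofCoordinates]
  constructor
  · rintro ⟨i, k, hi, hk, rfl⟩
    obtain ⟨j, hj, hk⟩ := Option.bind_eq_some_iff.1 hk
    exact ⟨p.right j, mem_ofCoordinates.2 ⟨i, j, hi, hj, rfl⟩, j, (p.right j).2,
      mem_ofCoordinates_coe.2 ⟨k, hk, rfl⟩⟩
  · rintro ⟨y, hy, x', hx', hz⟩
    obtain ⟨i, j, hi, hj, rfl⟩ := mem_ofCoordinates.1 hy
    obtain rfl : (j : X) = x' := Part.mem_unique (p.right j).2 hx'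
    obtain ⟨k, hk, rfl⟩ := mem_ofCoordinates_coe.1 hz
    exact ⟨i, k, hi, Option.bind_eq_some_iff.2 ⟨j, hj, hk⟩, rfl⟩

theorem isRegularElement_ofCoordinates (q : Coordinates a) :
    IsRegularElement (ofCoordinates q) := by
  obtain ⟨n, hn⟩ := PartialTransformation.exists_mul_mul_eq q.mid
  refine ⟨ofCoordinates ⟨q.left, n, q.right⟩, ?_⟩
  rw [← ofCoordinates_mul, ← ofCoordinates_mul]
  exact congrArg ofCoordinates (RectangularProduct.ext rfl hn.symm rfl)

/-- The homomorphism from the coordinates to the regular part. -/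
noncomputable def coordinatesHom (a : Y →. X) : Coordinates a →ₙ* regularPart a where
  toFun q := ⟨ofCoordinates q, isRegularElement_ofCoordinates q⟩
  map_mul' p q := Subtype.ext (ofCoordinates_mul p q)

/-- On the image of a regular element `f` the map `a` is defined and injective, and `f` attains all
its values on `im a`. -/
theorem exists_of_isRegularElement {f : SandwichPT a} (hf : IsRegularElement f) {x : X} {y : Y}
    (hy : y ∈ f x) : (∃ i : a.ran, y ∈ f i) ∧
      ∃ j : a.ran, (j : X) ∈ a y ∧ ∀ x' y', y' ∈ f x' → (j : X) ∈ a y' → y' = y := by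
  obtain ⟨g, hg⟩ := hf
  have key : ∀ {x y}, y ∈ f x → ∃ x₂ ∈ a y, ∃ y₃ ∈ g x₂, ∃ x₄ ∈ a y₃, y ∈ f x₄ := by
    intro x y hy
    have h := hy
    rw [hg, mem_mul] at h
    obtain ⟨y₃, hy₃, x₄, hx₄, h⟩ := h
    obtain ⟨y₁, hy₁, x₂, hx₂, h₃⟩ := mem_mul.1 hy₃
    obtain rfl := Part.mem_unique hy hy₁
    exact ⟨x₂, hx₂, y₃, h₃, x₄, hx₄, h⟩
  obtain ⟨x₂, hx₂, y₃, hy₃, x₄, hx₄, h⟩ := key hy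
  refine ⟨⟨⟨x₄, y₃, hx₄⟩, h⟩, ⟨x₂, y, hx₂⟩, hx₂, fun x' y' hy' hj => ?_⟩
  obtain ⟨x₂', hx₂', y₃', hy₃', x₄', hx₄', h'⟩ := key hy'
  obtain rfl := Part.mem_unique hj hx₂'
  obtain rfl := Part.mem_unique hy₃ hy₃'
  obtain rfl := Part.mem_unique hx₄ hx₄'
  exact Part.mem_unique h' h

/-- A function to options with a prescribed functional relation as graph. -/
theorem exists_option_valued {α β : Type*} {r : α → β → Prop}
    (hr : ∀ x y z, r x y → r x z → y = z) : ∃ f : α → Option β, ∀ x y, f x = some y ↔ r x y := by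
  classical
  refine ⟨fun x => if h : ∃ y, r x y then some h.choose else none, fun x y => ?_⟩
  by_cases h : ∃ y, r x y
  · simp only [h, dite_true, Option.some.injEq]
    exact ⟨fun e => e ▸ h.choose_spec, fun hy => hr x _ _ h.choose_spec hy⟩
  · simp only [h, dite_false, reduceCtorEq, false_iff]
    exact fun hy => h ⟨y, hy⟩

theorem coordinatesHom_surjective : Function.Surjective (coordinatesHom a) := by
  classical
  rintro ⟨f, hf⟩
  have hf : IsRegularElement f := hf
  obtain ⟨m, hm⟩ := exists_option_valued (r := fun i j : a.ran => ∃ y ∈ f i, (j : X) ∈ a y) <| by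
    rintro i j k ⟨y, hy, hj⟩ ⟨z, hz, hk⟩
    obtain rfl := Part.mem_unique hy hz
    exact Subtype.ext (Part.mem_unique hj hk)
  have ht : ∀ j : a.ran, ∃ y : ↥{y : Y | (j : X) ∈ a y},
      ∀ x y', y' ∈ f x → (j : X) ∈ a y' → y' = y := by
    intro j
    by_cases h : ∃ x, ∃ y ∈ f x, (j : X) ∈ a y
    · obtain ⟨x, y, hy, hj⟩ := h
      obtain ⟨-, k, hk, h⟩ := exists_of_isRegularElement hf hy
      obtain rfl : k = j := Subtype.ext (Part.mem_unique hk hj)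
      exact ⟨⟨y, hj⟩, h⟩
    · push Not at h
      exact ⟨⟨_, j.2.choose_spec⟩, fun x y' h1 h2 => absurd h2 (h x y' h1)⟩
  choose t ht using ht
  -- outside `im a` the retraction picks a point of `im a` with the same value under `f`
  have hη : ∀ b : ↥(a.ranᶜ), ∃ o : Option a.ran,
      (∀ i, o = some i → f i = f b) ∧ ∀ y ∈ f b, o.isSome := by
    intro b
    by_cases h : ∃ y, y ∈ f b
    · obtain ⟨y, hy⟩ := h
      obtain ⟨⟨i, hi⟩, -⟩ := exists_of_isRegularElement hf hy
      refine ⟨some i, fun j hj => ?_, fun _ _ => rfl⟩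
      obtain rfl := Option.some_injective _ hj
      exact (Part.eq_some_iff.2 hi).trans (Part.eq_some_iff.2 hy).symm
    · push Not at h
      exact ⟨none, fun _ h => by simp at h, fun y hy => absurd hy (h y)⟩
  choose η hη hη' using hη
  let q : Coordinates a := ⟨η, ⟨m⟩, t⟩
  have key : ∀ (i : a.ran) y, y ∈ ofCoordinates q i ↔ y ∈ f i := by
    intro i y
    rw [mem_ofCoordinates_coe]
    constructor
    · rintro ⟨j, hj, rfl⟩
      obtain ⟨y, hy, hj⟩ := (hm i j).1 hj
      exact ht j _ _ hy hj ▸ hy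
    · intro hy
      obtain ⟨-, j, hj, -⟩ := exists_of_isRegularElement hf hy
      exact ⟨j, (hm i j).2 ⟨y, hy, hj⟩, (ht j _ _ hy hj).symm⟩
  refine ⟨q, Subtype.ext (PFun.ext fun x y => ?_)⟩
  change y ∈ ofCoordinates q x ↔ y ∈ f x
  by_cases hx : x ∈ a.ran
  · exact key ⟨x, hx⟩ y
  let b : ↥(a.ranᶜ) := ⟨x, hx⟩
  have hb : q.left.extend x = η b := Retraction.extend_compl η b
  constructor
  · intro h
    obtain ⟨i, j, hi, hj, hy⟩ := mem_ofCoordinates.1 h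
    have := (key i y).1 (mem_ofCoordinates_coe.2 ⟨j, hj, hy⟩)
    rwa [hη b i (hb.symm.trans hi)] at this
  · intro h
    obtain ⟨i, hi⟩ := Option.isSome_iff_exists.1 (hη' b y h)
    obtain ⟨j, hj, hy⟩ := mem_ofCoordinates_coe.1 <|
      (key i y).2 (by rw [hη b i hi]; exact h)
    exact mem_ofCoordinates.2 ⟨i, j, hb.trans hi, hj, hy⟩

theorem mid_eq_iff_of_ofCoordinates {q : Coordinates a} {i j : a.ran} :
    q.mid i = some j ↔ ∃ y ∈ ofCoordinates q i, (j : X) ∈ a y := by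
  constructor
  · exact fun h => ⟨q.right j, mem_ofCoordinates_coe.2 ⟨j, h, rfl⟩, (q.right j).2⟩
  · rintro ⟨y, hy, hj⟩
    obtain ⟨k, hk, rfl⟩ := mem_ofCoordinates_coe.1 hy
    obtain rfl : k = j := Subtype.ext (Part.mem_unique (q.right k).2 hj)
    exact hk

theorem mid_eq_of_coordinatesHom_eq {p q : Coordinates a}
    (h : coordinatesHom a p = coordinatesHom a q) : p.mid = q.mid := by
  have h' : ofCoordinates p = ofCoordinates q := congrArg Subtype.val h
  refine PartialTransformation.ext_apply fun i => Option.ext fun j => ?_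
  rw [mid_eq_iff_of_ofCoordinates, mid_eq_iff_of_ofCoordinates, h']

/-- Above the group of units the coordinates are unique. -/
theorem eq_of_coordinatesHom_eq {p q : Coordinates a}
    (h : coordinatesHom a p = coordinatesHom a q) (hq : IsUnit q.mid) : p = q := by
  have h' : ofCoordinates p = ofCoordinates q := congrArg Subtype.val h
  have hm := mid_eq_of_coordinatesHom_eq h
  obtain ⟨σ, hσ⟩ := PartialTransformation.isUnit_iff.1 hq
  have hpσ : ∀ i, p.mid i = some (σ⁻¹ i) := fun i => by rw [hm, hσ]; rfl
  have hqσ : ∀ i, q.mid i = some (σ⁻¹ i) := fun i => by rw [hσ]; rfl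
  have hr : p.right = q.right := by
    refine funext fun j => Subtype.ext ?_
    have hy : (p.right j : Y) ∈ ofCoordinates q (σ j) := h' ▸
      mem_ofCoordinates_coe.2 ⟨j, by simp [hpσ], rfl⟩
    obtain ⟨k, hk, e⟩ := mem_ofCoordinates_coe.1 hy
    obtain rfl : j = k := by simpa [hqσ] using hk
    exact e.symm
  refine RectangularProduct.ext (funext fun b => Option.ext fun i => ?_) hm hr
  have key : ∀ p : Coordinates a, (∀ i, p.mid i = some (σ⁻¹ i)) →
      (p.left b = some i ↔ ∃ y ∈ ofCoordinates p b, ((σ⁻¹ i : a.ran) : X) ∈ a y) := by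
    intro p hp
    rw [← Retraction.extend_compl p.left b]
    constructor
    · intro hi
      exact ⟨_, mem_ofCoordinates.2 ⟨i, _, hi, hp i, rfl⟩, (p.right _).2⟩
    · rintro ⟨y, hy, hi⟩
      obtain ⟨k, j, hk, hj, rfl⟩ := mem_ofCoordinates.1 hy
      have e : j = σ⁻¹ i := Subtype.ext (Part.mem_unique (p.right j).2 hi)
      have : σ⁻¹ k = σ⁻¹ i := e ▸ (Option.some_injective _ ((hp k).symm.trans hj))
      rwa [σ⁻¹.injective this] at hk
  rw [key p hpσ, key q hqσ, h']

end SandwichPT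

/-! ### Generating sets and cardinalities -/

theorem Subsemigroup.mk_le_of_closure_eq_top {S : Type u} [Semigroup S] {G : Set S}
    (hG : Subsemigroup.closure G = ⊤) : #S ≤ max ℵ₀ #G := by
  have h1 : #S ≤ #(FreeSemigroup G) := by
    refine Cardinal.mk_le_of_surjective
      (f := FreeSemigroup.lift (Subtype.val : G → S)) fun x => ?_
    have hle : Subsemigroup.closure G ≤ (FreeSemigroup.lift (Subtype.val : G → S)).srange :=
      Subsemigroup.closure_le.2 fun g hg => ⟨FreeSemigroup.of ⟨g, hg⟩, FreeSemigroup.lift_of _ _⟩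
    exact hle (hG ▸ Subsemigroup.mem_top x)
  have h2 : #(FreeSemigroup G) ≤ #(List G) :=
    Cardinal.mk_le_of_injective (f := fun w : FreeSemigroup G => w.head :: w.tail) fun w w' h => by
      obtain ⟨h1, h2⟩ := List.cons_eq_cons.1 h
      exact FreeSemigroup.ext h1 h2
  exact h1.trans (h2.trans (Cardinal.mk_list_le_max _))

theorem semigroupRank_le {S : Type u} [Semigroup S] {G : Set S}
    (hG : Subsemigroup.closure G = ⊤) : semigroupRank S ≤ #G :=
  csInf_le' ⟨G, hG, rfl⟩

theorem le_semigroupRank {S : Type u} [Semigroup S] {κ : Cardinal.{u}}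
    (h : ∀ G : Set S, Subsemigroup.closure G = ⊤ → κ ≤ #G) : κ ≤ semigroupRank S :=
  le_csInf ⟨_, Set.univ, Subsemigroup.closure_univ, rfl⟩ <| by
    rintro _ ⟨G, hG, rfl⟩
    exact h G hG

theorem semigroupRank_eq_one {S : Type u} [Semigroup S] [Nonempty S] [Subsingleton S] :
    semigroupRank S = 1 := by
  refine le_antisymm ?_ (le_semigroupRank fun G hG => ?_)
  · refine (semigroupRank_le (G := Set.univ) Subsemigroup.closure_univ).trans ?_
    rw [Cardinal.mk_univ, Cardinal.le_one_iff_subsingleton]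
    infer_instance
  · rw [Cardinal.one_le_iff_ne_zero, Cardinal.mk_ne_zero_iff, Set.nonempty_coe_sort,
      Set.nonempty_iff_ne_empty]
    rintro rfl
    have := hG ▸ Subsemigroup.mem_top (Classical.arbitrary S)
    rw [Subsemigroup.closure_empty] at this
    exact this

theorem finite_of_countable_fun {C : Type*} {I : Type*} [Nonempty I] [Countable (C → Option I)] :
    Finite C := by
  classical
  by_contra h
  rw [not_finite_iff_infinite] at h
  let i := Classical.arbitrary I
  have hinj : Function.Injective fun (s : Set C) (c : C) => if c ∈ s then some i else none := by
    intro s t e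
    ext c
    have := congrFun e c
    by_cases h1 : c ∈ s <;> by_cases h2 : c ∈ t <;> simp_all
  have : Countable (Set C) := hinj.countable
  have h1 := Cardinal.mk_le_aleph0 (α := Set C)
  rw [Cardinal.mk_set] at h1
  exact ((Cardinal.aleph0_le_mk C).trans_lt (Cardinal.cantor _)).not_ge h1

namespace SandwichPT

variable {X : Type u} {Y : Type v} {a : Y →. X}

/-- A generating set of the regular part lifts to a set of coordinates of the same size that
generates everything over the units and covers all partial transformations. -/
theorem exists_lift_of_closure_eq_top {G : Set (regularPart a)}
    (hG : Subsemigroup.closure G = ⊤) : ∃ A : Set (Coordinates a), #A = #G ∧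
      (∀ q, IsUnit q.mid → q ∈ Subsemigroup.closure A) ∧
      ∀ m, ∃ q ∈ Subsemigroup.closure A, q.mid = m := by
  let s := Function.surjInv (coordinatesHom_surjective (a := a))
  have hs : ∀ f, coordinatesHom a (s f) = f := Function.surjInv_eq _
  have hsG : coordinatesHom a '' (s '' G) = G := by
    rw [← Set.image_comp, show (coordinatesHom a) ∘ s = id from funext hs, Set.image_id]
  have key : ∀ q, ∃ p ∈ Subsemigroup.closure (s '' G), coordinatesHom a p = coordinatesHom a q := by
    intro q
    have : coordinatesHom a q ∈ (Subsemigroup.closure (s '' G)).map (coordinatesHom a) := by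
      rw [MulHom.map_mclosure, hsG, hG]
      trivial
    exact this
  refine ⟨s '' G, Cardinal.mk_image_eq (Function.injective_surjInv _), fun q hq => ?_, fun m => ?_⟩
  · obtain ⟨p, hp, e⟩ := key q
    exact eq_of_coordinatesHom_eq e hq ▸ hp
  · obtain ⟨p, hp, e⟩ := key ⟨fun _ => none, m, Classical.arbitrary _⟩
    exact ⟨p, hp, mid_eq_of_coordinatesHom_eq e⟩

theorem max_le_mk_inter [Finite a.ran] {A : Set (Coordinates a)}
    (hA : ∀ q, IsUnit q.mid → q ∈ Subsemigroup.closure A) :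
    max (Cardinal.lift.{v} ((alpha a + 1) ^ beta a)) (Lam a) ≤ #↥(A ∩ {p | IsUnit p.mid}) := by
  refine max_le ?_ ?_
  · rw [← mk_retraction]
    have := Cardinal.lift_mk_le_lift_mk_of_surjective (RectangularProduct.surjective_left hA)
    rwa [Cardinal.lift_umax.{u, v}, Cardinal.lift_id'.{u, max u v}] at this
  · rw [← mk_aSection]
    exact Cardinal.mk_le_of_surjective (RectangularProduct.surjective_right hA)

theorem mk_eq_diff_add_inter (A : Set (Coordinates a)) :
    #A = #↥(A \ {p | IsUnit p.mid}) + #↥(A ∩ {p | IsUnit p.mid}) := by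
  rw [← Cardinal.mk_union_of_disjoint, Set.sdiff_union_inter]
  exact Set.disjoint_sdiff_inter

/-- The upper bound for the rank: elements indexed by `K` over permutations, and two (only one if
`im a` is a point) over collapses. -/
theorem semigroupRank_le_of_surjective [Finite a.ran] {K : Type (max u v)}
    {l : K → Retraction a} {s : K → Equiv.Perm a.ran} {r : K → ASection a}
    (hs : Submonoid.closure (Set.range s) = ⊤) (hl : Function.Surjective l)
    (hr : Function.Surjective r) [DecidableEq a.ran] {E : Set (Coordinates a)} {z₀ : a.ran}
    {l₀ : Retraction a} {r₀ : ASection a}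
    (h₁ : ⟨l₀, .collapse z₀ none, r₀⟩ ∈ E)
    (h₂ : Subsingleton a.ran ∨ ∃ w₀ ≠ z₀, ⟨l₀, .collapse z₀ (some w₀), r₀⟩ ∈ E) :
    semigroupRank (regularPart a) ≤ #E + #K := by
  let F : K → Coordinates a := fun k => ⟨l k, PartialTransformation.ofPerm (s k), r k⟩
  have htop : Subsemigroup.closure (E ∪ Set.range F) = ⊤ := by
    refine (Subsemigroup.eq_top_iff' _).2 ?_
    have sub := Subsemigroup.subset_closure (s := E ∪ Set.range F)
    refine RectangularProduct.mem_of_ofPerm_mem _ ?_ (sub (.inl h₁))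
      (h₂.imp_right fun ⟨w, hw, h⟩ => ⟨w, hw, sub (.inl h)⟩)
    exact RectangularProduct.mk_mem_of_submonoid_closure_eq_top PartialTransformation.ofPerm _
      hs hl hr fun k => sub (.inr ⟨k, rfl⟩)
  have hG : Subsemigroup.closure (coordinatesHom a '' (E ∪ Set.range F)) = ⊤ := by
    rw [← MulHom.map_mclosure, htop]
    exact (Subsemigroup.eq_top_iff' _).2 fun f => by
      obtain ⟨q, rfl⟩ := coordinatesHom_surjective f
      exact ⟨q, trivial, rfl⟩
  exact (semigroupRank_le hG).trans <| Cardinal.mk_image_le.trans <|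
    (Cardinal.mk_union_le _ _).trans (add_le_add_right Cardinal.mk_range_le _)

theorem exists_surjective_of_max_le {K : Type (max u v)}
    (hK : max (Cardinal.lift.{v} ((alpha a + 1) ^ beta a)) (Lam a) ≤ #K) :
    (∃ l : K → Retraction a, Function.Surjective l) ∧
      ∃ r : K → ASection a, Function.Surjective r := by
  rw [← mk_retraction, ← mk_aSection, max_le_iff] at hK
  have h1 : Cardinal.lift.{max u v} #(Retraction a) ≤ Cardinal.lift.{u} #K := by
    rw [Cardinal.lift_umax.{u, v}, Cardinal.lift_id'.{u, max u v}]
    exact hK.1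
  obtain ⟨f⟩ := Cardinal.lift_mk_le'.1 h1
  obtain ⟨g⟩ := Cardinal.le_def _ _ |>.1 hK.2
  have : Nonempty (Retraction a) := ⟨fun _ => none⟩
  exact ⟨⟨_, Function.invFun_surjective f.injective⟩, ⟨_, Function.invFun_surjective g.injective⟩⟩

theorem finite_of_countable_regularPart [Nonempty a.ran] [Countable (regularPart a)] :
    Finite a.ran ∧ Finite ↥(a.ranᶜ) := by
  let r₀ : ASection a := Classical.arbitrary _
  constructor
  · have hinj : Function.Injective fun m : a.ran → Option a.ran =>
        coordinatesHom a ⟨fun _ => none, ⟨m⟩, r₀⟩ := fun m n h =>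
      congrArg PartialTransformation.toFun (mid_eq_of_coordinatesHom_eq h)
    have := hinj.countable
    exact finite_of_countable_fun (I := a.ran)
  · have hinj : Function.Injective fun l : Retraction a =>
        coordinatesHom a ⟨l, 1, r₀⟩ := fun m n h =>
      congrArg RectangularProduct.left (eq_of_coordinatesHom_eq h isUnit_one)
    have := hinj.countable
    exact finite_of_countable_fun (I := a.ran)

theorem finite_aSection_of_finite_regularPart [Finite (regularPart a)] : Finite (ASection a) := by
  have hinj : Function.Injective fun r : ASection a =>
      coordinatesHom a ⟨fun _ => none, 1, r⟩ := fun m n h =>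
    congrArg RectangularProduct.right (eq_of_coordinatesHom_eq h isUnit_one)
  exact Finite.of_injective _ hinj

theorem finite_of_finite_regularPart [Nonempty a.ran] [Finite (regularPart a)] :
    Finite X ∧ ∀ i : a.ran, Finite ↥{y : Y | (i : X) ∈ a y} := by
  obtain ⟨h1, h2⟩ := finite_of_countable_regularPart (a := a)
  have h3 := finite_aSection_of_finite_regularPart (a := a)
  refine ⟨?_, fun i => ?_⟩
  · rw [← Set.finite_univ_iff, ← Set.union_compl_self a.ran]
    exact Set.Finite.union (Set.toFinite _) (Set.toFinite _)
  · classical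
    refine Finite.of_surjective (fun t : ASection a => t i) fun y => ?_
    exact ⟨Function.update (Classical.arbitrary _) i y, by simp⟩

theorem subsingleton_regularPart [IsEmpty a.ran] : Subsingleton (regularPart a) := by
  have : Subsingleton (Coordinates a) := ⟨fun p q =>
    RectangularProduct.ext (funext fun _ => Subsingleton.elim _ _)
      (PartialTransformation.ext_apply isEmptyElim) (Subsingleton.elim _ _)⟩
  exact coordinatesHom_surjective.subsingleton

instance : Nonempty (regularPart a) :=
  ⟨coordinatesHom a ⟨fun _ => none, 1, Classical.arbitrary _⟩⟩

/-- An infinite regular part is not finitely generated: otherwise it is countable, so `X` is finite,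
and the sections, of which every one belongs to a generator, are finite in number as well. -/
theorem semigroupRank_regularPart_of_infinite [Infinite (regularPart a)] :
    semigroupRank (regularPart a) = #(regularPart a) := by
  refine le_antisymm ?_ (le_semigroupRank fun G hG => ?_)
  · exact (semigroupRank_le Subsemigroup.closure_univ).trans Cardinal.mk_univ.le
  have hle := Subsemigroup.mk_le_of_closure_eq_top hG
  by_cases hfin : #G < ℵ₀
  · exfalso
    rw [max_eq_left hfin.le] at hle
    have : Countable (regularPart a) := Cardinal.mk_le_aleph0_iff.1 hle
    have : Nonempty a.ran := by
      by_contra h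
      rw [not_nonempty_iff] at h
      have := subsingleton_regularPart (a := a)
      exact not_finite (regularPart a)
    obtain ⟨h1, h2⟩ := finite_of_countable_regularPart (a := a)
    obtain ⟨A, hAG, hA, -⟩ := exists_lift_of_closure_eq_top hG
    have : Finite A := Cardinal.lt_aleph0_iff_finite.1 (hAG ▸ hfin)
    have : Finite ↥(A ∩ {p | IsUnit p.mid}) := Finite.Set.finite_inter_of_left _ _
    have : Finite (ASection a) := Finite.of_surjective _ (RectangularProduct.surjective_right hA)
    have := Finite.of_surjective _ (coordinatesHom_surjective (a := a))
    exact not_finite (regularPart a)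
  · rwa [max_eq_right (not_lt.1 hfin)] at hle

theorem semigroupRank_of_alpha_eq_one (h : alpha a = 1) :
    semigroupRank (regularPart a) =
      1 + max (Cardinal.lift.{v} ((alpha a + 1) ^ beta a)) (Lam a) := by
  classical
  obtain ⟨hs, ⟨z₀⟩⟩ := Cardinal.eq_one_iff_unique.1 h
  have : Nonempty a.ran := ⟨z₀⟩
  refine le_antisymm ?_ (le_semigroupRank fun G hG => ?_)
  · set κ := max (Cardinal.lift.{v} ((alpha a + 1) ^ beta a)) (Lam a) with hκ
    obtain ⟨⟨l, hl⟩, ⟨r, hr⟩⟩ := exists_surjective_of_max_le (a := a) (Cardinal.mk_out κ).ge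
    refine (semigroupRank_le_of_surjective (s := fun _ => 1) (Subsingleton.elim _ _) hl hr
      (E := {⟨fun _ => none, .collapse z₀ none, Classical.arbitrary _⟩}) rfl (.inl hs)).trans ?_
    rw [Cardinal.mk_singleton, Cardinal.mk_out]
  · obtain ⟨A, hAG, hA, hA'⟩ := exists_lift_of_closure_eq_top hG
    rw [← hAG, mk_eq_diff_add_inter]
    exact add_le_add (RectangularProduct.one_le_mk_diff hA') (max_le_mk_inter hA)

theorem semigroupRank_le_two_add [Finite a.ran] [Nontrivial a.ran] {κ : Cardinal.{max u v}}
    (hκ : max (Cardinal.lift.{v} ((alpha a + 1) ^ beta a)) (Lam a) ≤ κ)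
    {s : κ.out → Equiv.Perm a.ran} (hs : Submonoid.closure (Set.range s) = ⊤) :
    semigroupRank (regularPart a) ≤ 2 + κ := by
  classical
  obtain ⟨⟨l, hl⟩, ⟨r, hr⟩⟩ := exists_surjective_of_max_le (hκ.trans (Cardinal.mk_out κ).ge)
  obtain ⟨z₀, w₀, hw⟩ := exists_pair_ne a.ran
  let l₀ : Retraction a := fun _ => none
  let r₀ : ASection a := Classical.arbitrary _
  refine (semigroupRank_le_of_surjective hs hl hr (z₀ := z₀) (l₀ := l₀) (r₀ := r₀)
    (E := {⟨l₀, .collapse z₀ none, r₀⟩, ⟨l₀, .collapse z₀ (some w₀), r₀⟩}) (.inl rfl)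
    (.inr ⟨w₀, hw.symm, .inr rfl⟩)).trans ?_
  rw [Cardinal.mk_out]
  gcongr
  refine Cardinal.mk_insert_le.trans ?_
  rw [Cardinal.mk_singleton, one_add_one_eq_two]

theorem semigroupRank_of_alpha_eq_two (h : alpha a = 2) :
    semigroupRank (regularPart a) =
      2 + max (Cardinal.lift.{v} ((alpha a + 1) ^ beta a)) (Lam a) := by
  have : Finite a.ran :=
    Cardinal.lt_aleph0_iff_finite.1 (h.trans_lt (Cardinal.natCast_lt_aleph0 (n := 2)))
  have hc : Nat.card a.ran = 2 := (congrArg Cardinal.toNat h).trans (by simp)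
  have : Nontrivial a.ran := Finite.one_lt_card_iff_nontrivial.1 (by lia)
  refine le_antisymm ?_ (le_semigroupRank fun G hG => ?_)
  · obtain ⟨σ, hσ⟩ := Equiv.Perm.exists_submonoid_closure_singleton hc.le
    set κ := max (Cardinal.lift.{v} ((alpha a + 1) ^ beta a)) (Lam a) with hκ
    obtain ⟨-, ⟨r, hr⟩⟩ := exists_surjective_of_max_le (a := a) (Cardinal.mk_out κ).ge
    have : Nonempty κ.out := ⟨(hr (Classical.arbitrary _)).choose⟩
    exact semigroupRank_le_two_add (s := fun _ => σ) le_rfl (by rwa [Set.range_const])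
  · obtain ⟨A, hAG, hA, hA'⟩ := exists_lift_of_closure_eq_top hG
    rw [← hAG, mk_eq_diff_add_inter]
    exact add_le_add (RectangularProduct.two_le_mk_diff hA') (max_le_mk_inter hA)

theorem semigroupRank_of_three_le_alpha [Finite a.ran] (h : 3 ≤ alpha a) :
    semigroupRank (regularPart a) =
      2 + max (max (Cardinal.lift.{v} ((alpha a + 1) ^ beta a)) (Lam a)) 2 := by
  have hc : 3 ≤ Nat.card a.ran := by
    rw [alpha, ← Nat.cast_card] at h
    exact_mod_cast h
  have : Nontrivial a.ran := Finite.one_lt_card_iff_nontrivial.1 (by lia)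
  refine le_antisymm ?_ (le_semigroupRank fun G hG => ?_)
  · obtain ⟨σ, τ, hστ⟩ := Equiv.Perm.exists_submonoid_closure_pair (I := a.ran)
    set κ := max (max (Cardinal.lift.{v} ((alpha a + 1) ^ beta a)) (Lam a)) 2 with hκ
    have h2 : 2 ≤ #κ.out := (le_max_right _ _).trans (Cardinal.mk_out κ).ge
    obtain ⟨x, y, hxy⟩ := Cardinal.two_le_iff.1 h2
    classical
    refine semigroupRank_le_two_add (s := fun k => if k = x then σ else τ) (le_max_left _ _) ?_
    rw [← top_le_iff, ← hστ, Submonoid.closure_le]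
    rintro _ (rfl | rfl)
    · exact Submonoid.subset_closure ⟨x, by simp⟩
    · exact Submonoid.subset_closure ⟨y, by simp [hxy.symm]⟩
  · obtain ⟨A, hAG, hA, hA'⟩ := exists_lift_of_closure_eq_top hG
    rw [← hAG, mk_eq_diff_add_inter]
    exact add_le_add (RectangularProduct.two_le_mk_diff hA')
      (max_le (max_le_mk_inter hA) (RectangularProduct.two_le_mk_inter hc hA'))

end SandwichPT

theorem mainTheorem1 {X : Type u} {Y : Type v} (a : Y →. X) :
    (ℵ₀ ≤ #(regularPart a) → semigroupRank (regularPart a) = #(regularPart a)) ∧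
    (#(regularPart a) < ℵ₀ →
      (alpha a = 0 ∨ (#X < ℵ₀ ∧ ∀ i, lam a i < ℵ₀)) ∧
      (alpha a = 0 → semigroupRank (regularPart a) = 1) ∧
      (alpha a = 1 → semigroupRank (regularPart a) =
        1 + max (Cardinal.lift.{v} (2 ^ beta a)) (Lam a)) ∧
      (alpha a = 2 → semigroupRank (regularPart a) =
        2 + max (Cardinal.lift.{v} (3 ^ beta a)) (Lam a)) ∧
      (3 ≤ alpha a → semigroupRank (regularPart a) =
        2 + max (max (Cardinal.lift.{v} ((alpha a + 1) ^ beta a)) (Lam a)) 2)) := by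
  refine ⟨fun h => ?_, fun h => ⟨?_, fun h0 => ?_, fun h1 => ?_, fun h2 => ?_, fun h3 => ?_⟩⟩
  · have := Cardinal.aleph0_le_mk_iff.1 h
    exact semigroupRank_regularPart_of_infinite
  · have := Cardinal.lt_aleph0_iff_finite.1 h
    refine or_iff_not_imp_left.2 fun h0 => ?_
    have : Nonempty a.ran := Cardinal.mk_ne_zero_iff.1 h0
    obtain ⟨hX, hl⟩ := finite_of_finite_regularPart (a := a)
    exact ⟨Cardinal.lt_aleph0_iff_finite.2 hX, fun i => Cardinal.lt_aleph0_iff_finite.2 (hl i)⟩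
  · have : IsEmpty a.ran := Cardinal.mk_eq_zero_iff.1 h0
    have := subsingleton_regularPart (a := a)
    exact semigroupRank_eq_one
  · rw [semigroupRank_of_alpha_eq_one h1, h1, one_add_one_eq_two]
  · rw [semigroupRank_of_alpha_eq_two h2, h2, two_add_one_eq_three]
  · have := Cardinal.lt_aleph0_iff_finite.1 h
    have : Nonempty a.ran := Cardinal.mk_ne_zero_iff.1 fun h0 => by
      rw [alpha, h0] at h3
      exact absurd h3 (by norm_num)
    have := (finite_of_countable_regularPart (a := a)).1
    exact semigroupRank_of_three_le_alpha h3
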